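/- Let $(\bar M,\bar g)$ be an $(n+2)$-dimensional Lorentzian manifold with Levi-Civita connection $\bar\nabla$, and let $(M,g,S(TM))$ be a null hypersurface of it: $M$ is an immersed $(n+1)$-manifold whose induced metric $g$ is degenerate at every point, with radical line bundle $\mathrm{rad}(TM)=TM\cap TM^{\perp}$, and $S(TM)$ (the screen distribution) is a smooth rank $n$ subbundle of $TM$ with $TM=S(TM)\oplus\mathrm{rad}(TM)$. Suppose that $S(TM)$ is integrable, i.e. an $n$-dimensional integral manifold of $S(TM)$ passes through every point of $M$. Let $Z$ be a smooth vector field of $\bar M$ along $M$ which is parallel along $M$, i.e. $\bar\nabla_X Z=0$ for all $X\in TM$, and suppose that $(M,g,S(TM))$ has constant angle with respect to $Z$: $\bar g(Z,Z)$ vanishes nowhere on $M$, and there are smooth sections $\xi$ of $\mathrm{rad}(TM)$ and $N$ of $T\bar M|_M$ with $\bar g(\xi,N)=1$, $\bar g(N,N)=0$ and $\bar g(N,X)=0$ for $X\in S(TM)$, such that the functions $$\frac{\bar g(Z,\xi)}{|Z|}\quad\text{and}\quad\frac{\bar g(Z,N)}{|Z|},\qquad |Z|=\sqrt{|\bar g(Z,Z)|},$$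 are constant on $M$. Write $Z=\overset{*}{Z}+Z^{\perp}$ with $\overset{*}{Z}\in S(TM)$ and $Z^{\perp}\in S(TM)^{\perp}=\mathrm{span}(\xi,N)$, and for $X\in S(TM)$ let $A_{Z^{\perp}}X\in S(TM)$ be the $S(TM)$-component of $-\bar\nabla_X Z^{\perp}$. Then, at every point of $M$, $$A_{Z^{\perp}}\overset{*}{Z}=0 .$$ Consequently, wherever $\overset{*}{Z}\neq 0$, it is a principal direction (an eigenvector) of $A_{Z^{\perp}}$ with principal value $0$. -/

import Mathlib

open Set Filter Topology
open scoped Manifold ContDiff Bundle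

noncomputable section

/-- A smooth Lorentzian metric on an `m`-dimensional manifold `N`: a smooth symmetric
`(0,2)`-tensor field such that every tangent space contains a timelike vector `t` on whose
orthogonal complement the form is positive definite, i.e. of signature `(-,+,…,+)`. -/
structure LorentzianMetric (m : ℕ) (N : Type*) [TopologicalSpace N]
    [ChartedSpace (EuclideanSpace ℝ (Fin m)) N] [IsManifold (𝓡 m) ∞ N] where
  /-- the scalar product on each tangent space -/
  inner (x : N) : TangentSpace (𝓡 m) x →L[ℝ] TangentSpace (𝓡 m) x →L[ℝ] ℝ
  symm (x : N) (v w : TangentSpace (𝓡 m) x) : inner x v w = inner x w v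
  lorentz (x : N) : ∃ t : TangentSpace (𝓡 m) x, inner x t t < 0 ∧
    ∀ v : TangentSpace (𝓡 m) x, inner x t v = 0 → v ≠ 0 → 0 < inner x v v
  contMDiff : ContMDiff (𝓡 m)
    ((𝓡 m).prod 𝓘(ℝ, EuclideanSpace ℝ (Fin m) →L[ℝ] EuclideanSpace ℝ (Fin m) →L[ℝ] ℝ)) ∞
    (fun x => Bundle.TotalSpace.mk'
      (EuclideanSpace ℝ (Fin m) →L[ℝ] EuclideanSpace ℝ (Fin m) →L[ℝ] ℝ) x (inner x))

namespace LorentzianMetric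

variable {m : ℕ} {N : Type*} [TopologicalSpace N]
  [ChartedSpace (EuclideanSpace ℝ (Fin m)) N] [IsManifold (𝓡 m) ∞ N]

/-- The matrix of the metric in the chart `φ` around `x`, as a bilinear form on `ℝᵐ` depending on
the point `y` of the coordinate domain: `G_y(u,v) = g(Dφ⁻¹ u, Dφ⁻¹ v)` at the point `φ⁻¹ y`. -/
def gram (g : LorentzianMetric m N) (x : N) (y : EuclideanSpace ℝ (Fin m)) :
    EuclideanSpace ℝ (Fin m) →L[ℝ] EuclideanSpace ℝ (Fin m) →L[ℝ] ℝ :=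
  let A : EuclideanSpace ℝ (Fin m) →L[ℝ] EuclideanSpace ℝ (Fin m) :=
    mfderiv 𝓘(ℝ, EuclideanSpace ℝ (Fin m)) (𝓡 m) (extChartAt (𝓡 m) x).symm y
  let G : EuclideanSpace ℝ (Fin m) →L[ℝ] EuclideanSpace ℝ (Fin m) →L[ℝ] ℝ :=
    g.inner ((extChartAt (𝓡 m) x).symm y)
  G.bilinearComp A A

/-- The Christoffel map `u ↦ Γ_y(u,v)` of the Levi-Civita connection in the chart around `x`:
`G_y(Γ_y(u,v), w) = (∂_u G(v,w) + ∂_v G(u,w) - ∂_w G(v,u)) / 2` for all `w`. -/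
def christoffel (g : LorentzianMetric m N) (x : N) (y v : EuclideanSpace ℝ (Fin m)) :
    EuclideanSpace ℝ (Fin m) →L[ℝ] EuclideanSpace ℝ (Fin m) :=
  (g.gram x y).inverse ∘L
    ((1 / 2 : ℝ) • ((fderiv ℝ (g.gram x) y).flip v + fderiv ℝ (g.gram x) y v
      - ((fderiv ℝ (g.gram x) y).flip v).flip))

variable {k : ℕ} {M : Type*} [TopologicalSpace M] [ChartedSpace (EuclideanSpace ℝ (Fin k)) M]

/-- The covariant derivative `x ↦ ∇̄_x W` at `p` of a vector field `W` along `f : M → N`, for the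
Levi-Civita connection of the metric: in the chart `φ` of `N` around `f p`, with
`W^φ = Dφ W`, it is given by `D W^φ (x) + Γ(D(φ ∘ f) x, W^φ)`. -/
def covDerivAlong (g : LorentzianMetric m N) (f : M → N)
    (W : (q : M) → TangentSpace (𝓡 m) (f q)) (p : M) :
    TangentSpace (𝓡 k) p →L[ℝ] TangentSpace (𝓡 m) (f p) :=
  let Wφ : M → EuclideanSpace ℝ (Fin m) := fun q =>
    mfderiv (𝓡 m) 𝓘(ℝ, EuclideanSpace ℝ (Fin m)) (extChartAt (𝓡 m) (f p)) (f q) (W q)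
  let D : TangentSpace (𝓡 k) p →L[ℝ] EuclideanSpace ℝ (Fin m) :=
    mfderiv (𝓡 k) 𝓘(ℝ, EuclideanSpace ℝ (Fin m)) Wφ p
  let F : TangentSpace (𝓡 k) p →L[ℝ] EuclideanSpace ℝ (Fin m) :=
    mfderiv (𝓡 k) 𝓘(ℝ, EuclideanSpace ℝ (Fin m)) (fun q => extChartAt (𝓡 m) (f p) (f q)) p
  (mfderiv (𝓡 m) 𝓘(ℝ, EuclideanSpace ℝ (Fin m)) (extChartAt (𝓡 m) (f p)) (f p)).inverse ∘L
    (D + g.christoffel (f p) (extChartAt (𝓡 m) (f p) (f p)) (Wφ p) ∘L F)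

/-- The (possibly degenerate) bilinear form induced on `T_p M` by a map `f : M → N`. -/
def induced (g : LorentzianMetric m N) (f : M → N) (p : M) :
    LinearMap.BilinForm ℝ (TangentSpace (𝓡 k) p) :=
  LinearMap.mk₂ ℝ
    (fun x y => g.inner (f p) (mfderiv (𝓡 k) (𝓡 m) f p x) (mfderiv (𝓡 k) (𝓡 m) f p y))
    (by intros; simp) (by intros; simp) (by intros; simp) (by intros; simp)

/-- The radical `{x ∈ T_p M | g(x,y) = 0 for all y ∈ T_p M}` of the induced form. -/
def radical (g : LorentzianMetric m N) (f : M → N) (p : M) :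
    Submodule ℝ (TangentSpace (𝓡 k) p) :=
  LinearMap.ker (g.induced f p : LinearMap.BilinForm ℝ (TangentSpace (𝓡 k) p))

end LorentzianMetric

/-- A null hypersurface `(M, g, S(TM))` of an `(n+2)`-dimensional Lorentzian manifold `N`: an
immersion of the `(n+1)`-manifold `M` with degenerate induced metric, and a screen distribution,
that is, a smooth rank `n` subbundle `S(TM)` of `TM` complementary to the radical. -/
structure NullHypersurface {n : ℕ} {N : Type*} [TopologicalSpace N]
    [ChartedSpace (EuclideanSpace ℝ (Fin (n + 2))) N] [IsManifold (𝓡 (n + 2)) ∞ N]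
    (g : LorentzianMetric (n + 2) N) (M : Type*) [TopologicalSpace M]
    [ChartedSpace (EuclideanSpace ℝ (Fin (n + 1))) M] [IsManifold (𝓡 (n + 1)) ∞ M] where
  /-- the immersion -/
  map : M → N
  isImmersion : Manifold.IsImmersion (𝓡 (n + 1)) (𝓡 (n + 2)) ∞ map
  degenerate (p : M) :
    (g.radical map p : Submodule ℝ (TangentSpace (𝓡 (n + 1)) p)) ≠ ⊥
  /-- the screen distribution -/
  screen (p : M) : Submodule ℝ (TangentSpace (𝓡 (n + 1)) p)
  screen_smooth (p : M) : ∃ U ∈ 𝓝 p, ∃ e : Fin n → (q : M) → TangentSpace (𝓡 (n + 1)) q,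
    (∀ i, ContMDiffOn (𝓡 (n + 1)) (𝓡 (n + 1)).tangent ∞
      (fun q => (⟨q, e i q⟩ : TangentBundle (𝓡 (n + 1)) M)) U) ∧
    ∀ q ∈ U, LinearIndependent ℝ (fun i => e i q) ∧
      Submodule.span ℝ (Set.range fun i => e i q) = screen q
  isCompl (p : M) : IsCompl (screen p) (g.radical map p)

namespace NullHypersurface

variable {n : ℕ} {N : Type*} [TopologicalSpace N]
  [ChartedSpace (EuclideanSpace ℝ (Fin (n + 2))) N] [IsManifold (𝓡 (n + 2)) ∞ N]
  {g : LorentzianMetric (n + 2) N} {M : Type*} [TopologicalSpace M]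
  [ChartedSpace (EuclideanSpace ℝ (Fin (n + 1))) M] [IsManifold (𝓡 (n + 1)) ∞ M]

/-- The differential of the immersion, `T_p M → T_{f(p)} N`. -/
abbrev diff (H : NullHypersurface g M) (p : M) :
    TangentSpace (𝓡 (n + 1)) p →L[ℝ] TangentSpace (𝓡 (n + 2)) (H.map p) :=
  mfderiv (𝓡 (n + 1)) (𝓡 (n + 2)) H.map p

/-- Vector fields of the ambient manifold along `M` (not necessarily smooth). -/
abbrev FieldAlong (H : NullHypersurface g M) : Type _ :=
  (p : M) → TangentSpace (𝓡 (n + 2)) (H.map p)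

/-- Smoothness of a vector field along `M`. -/
def IsSmooth (H : NullHypersurface g M) (V : H.FieldAlong) : Prop :=
  ContMDiff (𝓡 (n + 1)) (𝓡 (n + 2)).tangent ∞
    (fun p => (⟨H.map p, V p⟩ : TangentBundle (𝓡 (n + 2)) N))

/-- `V` is parallel along `M`: `∇̄_x V = 0` for all `x ∈ TM`. -/
def IsParallel (H : NullHypersurface g M) (V : H.FieldAlong) : Prop :=
  ∀ (p : M) (x : TangentSpace (𝓡 (n + 1)) p), g.covDerivAlong H.map V p x = 0

/-- The screen distribution is integrable: through every point passes an integral manifold,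
parametrised by an immersion of an open neighbourhood of the origin of `ℝⁿ`. -/
def ScreenIntegrable (H : NullHypersurface g M) : Prop :=
  ∀ p : M, ∃ (c : EuclideanSpace ℝ (Fin n) → M) (U : Set (EuclideanSpace ℝ (Fin n))),
    IsOpen U ∧ 0 ∈ U ∧ c 0 = p ∧ ∀ u ∈ U,
      Manifold.IsImmersionAt (𝓡 n) (𝓡 (n + 1)) ∞ c u ∧
      (mfderiv (𝓡 n) (𝓡 (n + 1)) c u).range = H.screen (c u)

/-- A null frame `{ξ, ν}`: smooth sections `ξ` of `rad(TM)` and `ν` of `tr(TM)` with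
`ḡ(ξ,ν) = 1`, `ḡ(ν,ν) = 0` and `ḡ(ν,X) = 0` for `X ∈ S(TM)`. -/
structure IsNullFrame (H : NullHypersurface g M)
    (ξ : (p : M) → TangentSpace (𝓡 (n + 1)) p) (ν : H.FieldAlong) : Prop where
  smooth_radical : ContMDiff (𝓡 (n + 1)) (𝓡 (n + 1)).tangent ∞
    (fun p => (⟨p, ξ p⟩ : TangentBundle (𝓡 (n + 1)) M))
  smooth_transversal : H.IsSmooth ν
  mem_radical : ∀ p, ξ p ∈ (g.radical H.map p : Submodule ℝ (TangentSpace (𝓡 (n + 1)) p))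
  pairing : ∀ p, g.inner (H.map p) (H.diff p (ξ p)) (ν p) = 1
  null : ∀ p, g.inner (H.map p) (ν p) (ν p) = 0
  orthogonal : ∀ p, ∀ x ∈ H.screen p, g.inner (H.map p) (ν p) (H.diff p x) = 0

/-- The length `|V| = √|ḡ(V,V)|`. -/
def length (H : NullHypersurface g M) (V : H.FieldAlong) (p : M) : ℝ :=
  √|g.inner (H.map p) (V p) (V p)|

/-- `(M, g, S(TM))` has constant angle with respect to the nowhere null field `V`: for some null
frame `{ξ, ν}` the functions `ḡ(V,ξ)/|V|` and `ḡ(V,ν)/|V|` are constant. -/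
def HasConstantAngle (H : NullHypersurface g M) (V : H.FieldAlong) : Prop :=
  (∀ p, g.inner (H.map p) (V p) (V p) ≠ 0) ∧
  ∃ (ξ : (p : M) → TangentSpace (𝓡 (n + 1)) p) (ν : H.FieldAlong), H.IsNullFrame ξ ν ∧
    (∃ a : ℝ, ∀ p, g.inner (H.map p) (V p) (H.diff p (ξ p)) / H.length V p = a) ∧
    (∃ b : ℝ, ∀ p, g.inner (H.map p) (V p) (ν p) / H.length V p = b)

/-- The metric on the screen space `S(T_p M)`. -/
def screenMetric (H : NullHypersurface g M) (p : M) : LinearMap.BilinForm ℝ (H.screen p) :=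
  (g.induced H.map p).restrict (H.screen p)

theorem screenMetric_nondegenerate (H : NullHypersurface g M) (p : M) :
    (H.screenMetric p).Nondegenerate := by
  have key : ∀ x : H.screen p, (∀ y : H.screen p, H.screenMetric p x y = 0) → x = 0 := by
    intro x hx
    have hrad : (x : TangentSpace (𝓡 (n + 1)) p) ∈
        (g.radical H.map p : Submodule ℝ (TangentSpace (𝓡 (n + 1)) p)) := by
      rw [LorentzianMetric.radical, LinearMap.mem_ker]
      ext y
      have hy : y ∈ H.screen p ⊔ g.radical H.map p := by
        rw [(H.isCompl p).sup_eq_top]; trivial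
      obtain ⟨s, hs, r, hr, rfl⟩ := Submodule.mem_sup.1 hy
      have h1 : g.induced H.map p x s = 0 := hx ⟨s, hs⟩
      have h2 : g.induced H.map p x r = 0 := by
        have h3 : g.induced H.map p r x = 0 := by
          rw [LorentzianMetric.radical, LinearMap.mem_ker] at hr
          rw [hr]; rfl
        rw [← h3]
        exact g.symm _ _ _
      rw [map_add, h1, h2]
      simp
    have := (Submodule.disjoint_def.1 (H.isCompl p).disjoint) _ x.2 hrad
    exact Subtype.ext this
  refine ⟨key, fun x hx => key x fun y => ?_⟩
  rw [← hx y]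
  exact g.symm _ _ _

instance (H : NullHypersurface g M) (p : M) : FiniteDimensional ℝ (H.screen p) :=
  haveI : FiniteDimensional ℝ (TangentSpace (𝓡 (n + 1)) p) :=
    inferInstanceAs (FiniteDimensional ℝ (EuclideanSpace ℝ (Fin (n + 1))))
  inferInstance

/-- The projection of `T N` onto the screen. Since `rad(TM) ⊕ tr(TM) = S(TM)^⊥`, the projection
along `rad(TM) ⊕ tr(TM)` is the `ḡ`-orthogonal one: it sends `v` to the only element `s` of the
screen with `ḡ(s,y) = ḡ(v,y)` for all `y` in the screen. -/
def screenProj (H : NullHypersurface g M) (p : M) :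
    TangentSpace (𝓡 (n + 2)) (H.map p) →ₗ[ℝ] H.screen p :=
  ((H.screenMetric p).toDual (H.screenMetric_nondegenerate p)).symm.toLinearMap ∘ₗ
    LinearMap.mk₂ ℝ (fun v (y : H.screen p) => g.inner (H.map p) v (H.diff p y))
      (by intros; simp) (by intros; simp) (by intros; simp) (by intros; simp)

theorem screenProj_spec (H : NullHypersurface g M) (p : M)
    (v : TangentSpace (𝓡 (n + 2)) (H.map p)) (y : H.screen p) :
    g.inner (H.map p) (H.diff p (H.screenProj p v)) (H.diff p y) =
      g.inner (H.map p) v (H.diff p y) := by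
  have := LinearMap.BilinForm.apply_toDual_symm_apply (hB := H.screenMetric_nondegenerate p)
    (LinearMap.mk₂ ℝ (fun v (y : H.screen p) => g.inner (H.map p) v (H.diff p y))
      (by intros; simp) (by intros; simp) (by intros; simp) (by intros; simp) v) y
  exact this

/-- The screen component of a vector field along `M`. -/
def screenPart (H : NullHypersurface g M) (V : H.FieldAlong) (p : M) : H.screen p :=
  H.screenProj p (V p)

/-- The component `V^⊥ = V - V*` of `V` in `S(TM)^⊥ = rad(TM) ⊕ tr(TM)`. -/
def perpPart (H : NullHypersurface g M) (V : H.FieldAlong) : H.FieldAlong :=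
  fun p => V p - H.diff p (H.screenPart V p)

/-- The shape operator `A_W : S(T_p M) → S(T_p M)` of a section `W` of `S(TM)^⊥`: `A_W x` is the
screen component of `-∇̄_x W`. For integrable screens this is the shape operator, in the normal
direction `W`, of the leaves of `S(TM)` as codimension two submanifolds of `N`. -/
def shapeOperator (H : NullHypersurface g M) (W : H.FieldAlong) (p : M) :
    H.screen p →ₗ[ℝ] H.screen p :=
  -(H.screenProj p ∘ₗ (g.covDerivAlong H.map W p).toLinearMap ∘ₗ (H.screen p).subtype)

end NullHypersurface

end

/-! Put V = Z^⊥ and let y lie in the screen. Since V is normal to the leaves of the screen, its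
shape operator is symmetric, so ⟨∇̄_{Z*} V, y⟩ = ⟨∇̄_y V, Z*⟩ = ⟨∇̄_y V, Z⟩ - ⟨∇̄_y V, V⟩. As ∇̄Z =
0, metric compatibility turns the right side into y⟨V, Z⟩ - y⟨V, V⟩/2. Both ⟨V, Z⟩ and ⟨V, V⟩ equal
2 ḡ(Z,ξ) ḡ(Z,ν), which by the constant angle condition is a constant times |ḡ(Z,Z)|; since Z is
parallel, its derivative is zero. So ∇̄_{Z*} V has no screen component.

Three results carry this: `LorentzianMetric.hasMFDerivAt_inner` (compatibility),
`LorentzianMetric.inner_covDerivAlong_comm` (symmetry, from equality of mixed second derivatives)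
and `hasMFDerivAt_inner_mul_inner` (vanishing derivative). As the connection is defined by
Christoffel symbols, the first two are proved in a chart. -/

noncomputable section

/-! ### Product rules for a variable bilinear form -/

theorem differentiableAt_of_clm_apply {D E F : Type*} [NormedAddCommGroup D] [NormedSpace ℝ D]
    [NormedAddCommGroup E] [NormedSpace ℝ E] [NormedAddCommGroup F] [NormedSpace ℝ F]
    [FiniteDimensional ℝ E] {f : D → E →L[ℝ] F} {x : D}
    (h : ∀ v, DifferentiableAt ℝ (fun y => f y v) x) : DifferentiableAt ℝ f x := by
  let d := Module.finrank ℝ E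
  have hd : d = Module.finrank ℝ (Fin d → ℝ) := (Module.finrank_fin_fun ℝ).symm
  let e₁ := ContinuousLinearEquiv.ofFinrankEq hd
  let e₂ := (e₁.arrowCongr (1 : F ≃L[ℝ] F)).trans (ContinuousLinearEquiv.piRing (Fin d))
  rw [← Function.id_comp f, ← e₂.symm_comp_self]
  exact e₂.symm.differentiableAt.comp x (differentiableAt_pi.mpr fun i => h _)

theorem ContinuousLinearMap.isInvertible_of_injective_dual {E : Type*} [NormedAddCommGroup E]
    [NormedSpace ℝ E] [FiniteDimensional ℝ E] (B : E →L[ℝ] E →L[ℝ] ℝ)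
    (h : Function.Injective B) : B.IsInvertible := by
  have hdim : Module.finrank ℝ E = Module.finrank ℝ (E →L[ℝ] ℝ) := by
    rw [← (LinearMap.toContinuousLinearMap (𝕜 := ℝ) (E := E) (F' := ℝ)).finrank_eq]
    exact (Subspace.dual_finrank_eq (K := ℝ) (V := E)).symm
  refine ⟨(LinearEquiv.ofInjectiveOfFinrankEq (B : E →ₗ[ℝ] E →L[ℝ] ℝ) h
    hdim).toContinuousLinearEquiv, ?_⟩
  ext v w
  rfl

/-- The model has no boundary and the target is a vector space, so only the source chart remains.
This carries the flat product rule over to manifolds. -/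
theorem hasMFDerivAt_iff_hasFDerivAt_comp_symm {k : ℕ} {M : Type*} [TopologicalSpace M]
    [ChartedSpace (EuclideanSpace ℝ (Fin k)) M] {F : Type*} [NormedAddCommGroup F]
    [NormedSpace ℝ F] {h : M → F} {p : M} {h' : EuclideanSpace ℝ (Fin k) →L[ℝ] F} :
    HasMFDerivAt (𝓡 k) 𝓘(ℝ, F) h p h' ↔ ContinuousAt h p ∧
      HasFDerivAt (h ∘ (extChartAt (𝓡 k) p).symm) h' (extChartAt (𝓡 k) p p) := by
  simp only [HasMFDerivAt, writtenInExtChartAt, extChartAt_model_space_eq_id,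
    PartialEquiv.refl_coe, Function.id_comp, ModelWithCorners.range_eq_univ]
  exact and_congr_right fun _ => hasFDerivWithinAt_univ

set_option synthInstance.maxHeartbeats 200000 in
/-- The product rule for `z ↦ G(y z)(v z, w z)`. -/
theorem HasFDerivAt.bilinear_apply {D F : Type*} [NormedAddCommGroup D] [NormedSpace ℝ D]
    [NormedAddCommGroup F] [NormedSpace ℝ F] {z : D} {G : F → F →L[ℝ] F →L[ℝ] ℝ}
    {y v w : D → F} {y' v' w' : D →L[ℝ] F} (hG : DifferentiableAt ℝ G (y z))
    (hy : HasFDerivAt y y' z) (hv : HasFDerivAt v v' z) (hw : HasFDerivAt w w' z) :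
    HasFDerivAt (fun x => G (y x) (v x) (w x))
      (((fderiv ℝ G (y z)).flip (v z)).flip (w z) ∘L y' + (G (y z)).flip (w z) ∘L v'
        + G (y z) (v z) ∘L w') z := by
  have h1 : HasFDerivAt (fun x => G (y x)) (fderiv ℝ G (y z) ∘L y') z :=
    HasFDerivAt.comp (g := G) (g' := fderiv ℝ G (y z)) z hG.hasFDerivAt hy
  refine ((h1.clm_apply hv).clm_apply hw).congr_fderiv ?_
  ext x
  simp only [add_apply, ContinuousLinearMap.comp_apply,
    ContinuousLinearMap.flip_apply]
  ring

/-- The product rule for `q ↦ G(y q)(v q, w q)` on a manifold. -/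
theorem HasMFDerivAt.bilinear_apply {k : ℕ} {M : Type*} [TopologicalSpace M]
    [ChartedSpace (EuclideanSpace ℝ (Fin k)) M] {F : Type*} [NormedAddCommGroup F]
    [NormedSpace ℝ F] {p : M} {G : F → F →L[ℝ] F →L[ℝ] ℝ} {y v w : M → F}
    {y' v' w' : EuclideanSpace ℝ (Fin k) →L[ℝ] F}
    (hG : DifferentiableAt ℝ G (y p)) (hy : HasMFDerivAt (𝓡 k) 𝓘(ℝ, F) y p y')
    (hv : HasMFDerivAt (𝓡 k) 𝓘(ℝ, F) v p v') (hw : HasMFDerivAt (𝓡 k) 𝓘(ℝ, F) w p w') :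
    HasMFDerivAt (𝓡 k) 𝓘(ℝ, ℝ) (fun q => G (y q) (v q) (w q)) p
      (((fderiv ℝ G (y p)).flip (v p)).flip (w p) ∘L y' + (G (y p)).flip (w p) ∘L v'
        + G (y p) (v p) ∘L w') := by
  rw [hasMFDerivAt_iff_hasFDerivAt_comp_symm] at *
  have hc : ContinuousAt (fun q => G (y q)) p := ContinuousAt.comp hG.continuousAt hy.1
  refine ⟨(hc.clm_apply hv.1).clm_apply hw.1, ?_⟩
  have hp : (extChartAt (𝓡 k) p).symm (extChartAt (𝓡 k) p p) = p := extChartAt_to_inv p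
  have := HasFDerivAt.bilinear_apply (G := G) (by simpa [hp] using hG) hy.2 hv.2 hw.2
  simp only [Function.comp_apply, hp] at this
  exact this

/-! ### The metric and its Christoffel symbols in a chart -/

namespace LorentzianMetric

variable {m : ℕ} {N : Type*} [TopologicalSpace N]
  [ChartedSpace (EuclideanSpace ℝ (Fin m)) N] [IsManifold (𝓡 m) ∞ N]

/-- A nonzero vector orthogonal to everything is orthogonal to the timelike `t`, hence has positive
square, yet it is orthogonal to itself. -/
theorem nondegenerate (g : LorentzianMetric m N) (x : N) {v : TangentSpace (𝓡 m) x}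
    (hv : ∀ w, g.inner x v w = 0) : v = 0 := by
  obtain ⟨t, -, ht⟩ := g.lorentz x
  by_contra h
  have := ht v (by rw [g.symm]; exact hv t) h
  rw [hv v] at this
  exact lt_irrefl _ this

theorem gram_apply (g : LorentzianMetric m N) (x : N) (y v w : EuclideanSpace ℝ (Fin m)) :
    g.gram x y v w = g.inner ((extChartAt (𝓡 m) x).symm y)
      (mfderiv 𝓘(ℝ, EuclideanSpace ℝ (Fin m)) (𝓡 m) (extChartAt (𝓡 m) x).symm y v)
      (mfderiv 𝓘(ℝ, EuclideanSpace ℝ (Fin m)) (𝓡 m) (extChartAt (𝓡 m) x).symm y w) := rfl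

theorem gram_symm (g : LorentzianMetric m N) (x : N) (y v w : EuclideanSpace ℝ (Fin m)) :
    g.gram x y v w = g.gram x y w v := g.symm _ _ _

variable (m) in
theorem mfderiv_extChartAt_symm_mfderiv_apply {x q : N} (hq : q ∈ (extChartAt (𝓡 m) x).source)
    (v : TangentSpace (𝓡 m) q) :
    mfderiv 𝓘(ℝ, EuclideanSpace ℝ (Fin m)) (𝓡 m) (extChartAt (𝓡 m) x).symm
      (extChartAt (𝓡 m) x q)
      (mfderiv (𝓡 m) 𝓘(ℝ, EuclideanSpace ℝ (Fin m)) (extChartAt (𝓡 m) x) q v) = v := by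
  have : IsManifold (𝓡 m) 1 N := .of_le (n := ∞) (by simp)
  have h := mfderivWithin_extChartAt_symm_comp_mfderiv_extChartAt' (I := 𝓡 m) hq
  simp only [ModelWithCorners.range_eq_univ, mfderivWithin_univ] at h
  exact DFunLike.congr_fun h v

theorem gram_mfderiv_extChartAt (g : LorentzianMetric m N) {x q : N}
    (hq : q ∈ (extChartAt (𝓡 m) x).source) (v w : TangentSpace (𝓡 m) q) :
    g.gram x (extChartAt (𝓡 m) x q)
      (mfderiv (𝓡 m) 𝓘(ℝ, EuclideanSpace ℝ (Fin m)) (extChartAt (𝓡 m) x) q v)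
      (mfderiv (𝓡 m) 𝓘(ℝ, EuclideanSpace ℝ (Fin m)) (extChartAt (𝓡 m) x) q w)
      = g.inner q v w := by
  -- `φ⁻¹ (φ q)` equals `q` only propositionally; the equality is transported by regarding all
  -- tangent spaces as the model space.
  have key : ∀ (q' : N) (h : q' = q) (a b : TangentSpace (𝓡 m) q')
      , (a : EuclideanSpace ℝ (Fin m)) = v → (b : EuclideanSpace ℝ (Fin m)) = w →
      g.inner q' a b = g.inner q v w := by
    rintro q' rfl a b rfl rfl; rfl
  exact key _ ((extChartAt (𝓡 m) x).left_inv hq) _ _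
    (mfderiv_extChartAt_symm_mfderiv_apply m hq v) (mfderiv_extChartAt_symm_mfderiv_apply m hq w)

theorem isInvertible_gram (g : LorentzianMetric m N) (x : N) :
    (g.gram x (extChartAt (𝓡 m) x x)).IsInvertible := by
  have : IsManifold (𝓡 m) 1 N := .of_le (n := ∞) (by simp)
  have hx := mem_extChartAt_source (I := 𝓡 m) x
  apply ContinuousLinearMap.isInvertible_of_injective_dual
  rw [injective_iff_map_eq_zero]
  intro v hv
  obtain ⟨v', rfl⟩ := (isInvertible_mfderiv_extChartAt (I := 𝓡 m) hx).surjective v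
  have : v' = 0 := g.nondegenerate x fun w => by
    rw [← g.gram_mfderiv_extChartAt hx v' w, hv]; rfl
  rw [this, map_zero]; rfl

/-- A smooth tensor is evaluated on the local frame fields of the tangent bundle trivialization,
which are smooth. On the chart domain these are the coordinate fields, so the functions are the
entries of `gram`. -/
theorem contMDiffOn_inner_mfderiv_symm (g : LorentzianMetric m N) (x : N)
    (v w : EuclideanSpace ℝ (Fin m)) :
    ContMDiffOn (𝓡 m) 𝓘(ℝ, ℝ) ∞ (fun q => g.inner q
      ((trivializationAt (EuclideanSpace ℝ (Fin m)) (TangentSpace (𝓡 m)) x).symmL ℝ q v)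
      ((trivializationAt (EuclideanSpace ℝ (Fin m)) (TangentSpace (𝓡 m)) x).symmL ℝ q w))
      (chartAt (EuclideanSpace ℝ (Fin m)) x).source := by
  have hs := (trivializationAt (EuclideanSpace ℝ (Fin m)) (TangentSpace (𝓡 m) (M := N))
    x).contMDiffOn_symmL (n := ∞) (IB := 𝓡 m)
  have hc : ∀ u : EuclideanSpace ℝ (Fin m), ContMDiffOn (𝓡 m)
      ((𝓡 m).prod 𝓘(ℝ, EuclideanSpace ℝ (Fin m))) ∞
      (fun q : N => Bundle.TotalSpace.mk' (EuclideanSpace ℝ (Fin m)) q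
        ((trivializationAt (EuclideanSpace ℝ (Fin m)) (TangentSpace (𝓡 m)) x).symmL ℝ q u))
      (chartAt (EuclideanSpace ℝ (Fin m)) x).source := fun u => by
    refine ContMDiffOn.clm_bundle_apply (E₁ := Bundle.Trivial N (EuclideanSpace ℝ (Fin m)))
      (v := fun _ => u) hs ?_
    exact fun q _ => Bundle.contMDiffWithinAt_totalSpace.2
      ⟨contMDiffWithinAt_id, contMDiffWithinAt_const⟩
  have := ContMDiffOn.clm_bundle_apply₂ (E₃ := Bundle.Trivial N ℝ) g.contMDiff.contMDiffOn
    (hc v) (hc w)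
  exact fun q hq => (Bundle.contMDiffWithinAt_totalSpace.1 (this q hq)).2

theorem contDiffOn_gram_apply (g : LorentzianMetric m N) (x : N)
    (v w : EuclideanSpace ℝ (Fin m)) :
    ContDiffOn ℝ ∞ (fun y => g.gram x y v w) (extChartAt (𝓡 m) x).target := by
  have : IsManifold (𝓡 m) 1 N := .of_le (n := ∞) (by simp)
  have h := (g.contMDiffOn_inner_mfderiv_symm x v w).comp (contMDiffOn_extChartAt_symm x)
    (fun y hy => by
      rw [mem_preimage, ← extChartAt_source (𝓡 m)]
      exact (extChartAt (𝓡 m) x).map_target hy)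
  rw [← contMDiffOn_iff_contDiffOn]
  refine h.congr fun y hy => ?_
  have hs := (extChartAt (𝓡 m) x).map_target hy
  rw [extChartAt_source] at hs
  have := TangentBundle.symmL_trivializationAt (I := 𝓡 m) hs
  simp only [ModelWithCorners.range_eq_univ, mfderivWithin_univ] at this
  have key : ∀ z, z = y → ∀ u : EuclideanSpace ℝ (Fin m),
      (mfderiv 𝓘(ℝ, EuclideanSpace ℝ (Fin m)) (𝓡 m) (extChartAt (𝓡 m) x).symm y u :
        EuclideanSpace ℝ (Fin m)) =
      mfderiv 𝓘(ℝ, EuclideanSpace ℝ (Fin m)) (𝓡 m) (extChartAt (𝓡 m) x).symm z u := by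
    rintro z rfl u; rfl
  rw [gram_apply, Function.comp_apply, this]
  exact congrArg₂ (fun a b : EuclideanSpace ℝ (Fin m) =>
    g.inner ((extChartAt (𝓡 m) x).symm y) a b)
    (key _ ((extChartAt (𝓡 m) x).right_inv hy) v) (key _ ((extChartAt (𝓡 m) x).right_inv hy) w)

theorem differentiableAt_gram (g : LorentzianMetric m N) (x : N) :
    DifferentiableAt ℝ (g.gram x) (extChartAt (𝓡 m) x x) := by
  refine differentiableAt_of_clm_apply fun v => differentiableAt_of_clm_apply fun w => ?_
  exact ((g.contDiffOn_gram_apply x v w).contDiffAt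
    (extChartAt_target_mem_nhds x)).differentiableAt (by simp)

theorem fderiv_gram_symm (g : LorentzianMetric m N) (x : N) (u v w : EuclideanSpace ℝ (Fin m)) :
    fderiv ℝ (g.gram x) (extChartAt (𝓡 m) x x) u v w =
      fderiv ℝ (g.gram x) (extChartAt (𝓡 m) x x) u w v := by
  have h : ∀ v w, HasFDerivAt (fun y => g.gram x y v w)
      (((fderiv ℝ (g.gram x) (extChartAt (𝓡 m) x x)).flip v).flip w) (extChartAt (𝓡 m) x x) :=
    fun v w => by
      refine (((g.differentiableAt_gram x).hasFDerivAt.clm_apply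
        (hasFDerivAt_const v _)).clm_apply (hasFDerivAt_const w _)).congr_fderiv ?_
      ext; simp
  have h1 := h v w
  simp only [g.gram_symm x _ v w] at h1
  exact DFunLike.congr_fun (h1.unique (h w v)) u

/-- By `isInvertible_gram`, the `inverse` in `christoffel` is a true inverse and not the default
value `0`, so the Koszul formula holds. -/
theorem gram_christoffel (g : LorentzianMetric m N) (x : N)
    (u v w : EuclideanSpace ℝ (Fin m)) :
    g.gram x (extChartAt (𝓡 m) x x) (g.christoffel x (extChartAt (𝓡 m) x x) v u) w =
      (fderiv ℝ (g.gram x) (extChartAt (𝓡 m) x x) u v w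
        + fderiv ℝ (g.gram x) (extChartAt (𝓡 m) x x) v u w
        - fderiv ℝ (g.gram x) (extChartAt (𝓡 m) x x) w v u) / 2 := by
  simp only [christoffel, ContinuousLinearMap.comp_apply,
    (g.isInvertible_gram x).self_apply_inverse]
  simp
  ring

end LorentzianMetric
end

/-! ### The connection along a map: metric compatibility and symmetry of shape operators -/

noncomputable section

set_option synthInstance.maxHeartbeats 200000 in
/-- In coordinates: if `v` is orthogonal to the image of `dΦ`, then `⟨∇_a v, dΦ b⟩` is symmetric
in `a` and `b`, where `∇` is given by Christoffel symbols `Γ`. -/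
theorem bilinear_apply_covDeriv_comm {D F : Type*} [NormedAddCommGroup D] [NormedSpace ℝ D]
    [NormedAddCommGroup F] [NormedSpace ℝ F] {u₀ : D} {G : F → F →L[ℝ] F →L[ℝ] ℝ}
    {Φ v : D → F} {v' : D →L[ℝ] F} {Γ : F → F} (hG : DifferentiableAt ℝ G (Φ u₀))
    (hG' : ∀ a b c, fderiv ℝ G (Φ u₀) a b c = fderiv ℝ G (Φ u₀) a c b)
    (hΦ : ContDiffAt ℝ 2 Φ u₀) (hv : HasFDerivAt v v' u₀)
    (hΓ : ∀ a w, G (Φ u₀) (Γ a) w = (fderiv ℝ G (Φ u₀) a (v u₀) w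
      + fderiv ℝ G (Φ u₀) (v u₀) a w - fderiv ℝ G (Φ u₀) w (v u₀) a) / 2)
    (hperp : ∀ᶠ u in 𝓝 u₀, ∀ a, G (Φ u) (v u) (fderiv ℝ Φ u a) = 0) (a b : D) :
    G (Φ u₀) (v' a) (fderiv ℝ Φ u₀ b) + G (Φ u₀) (Γ (fderiv ℝ Φ u₀ a)) (fderiv ℝ Φ u₀ b) =
      G (Φ u₀) (v' b) (fderiv ℝ Φ u₀ a) +
        G (Φ u₀) (Γ (fderiv ℝ Φ u₀ b)) (fderiv ℝ Φ u₀ a) := by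
  have hΦ' : HasFDerivAt Φ (fderiv ℝ Φ u₀) u₀ := (hΦ.differentiableAt (by simp)).hasFDerivAt
  have hΦ'' : HasFDerivAt (fderiv ℝ Φ) (fderiv ℝ (fderiv ℝ Φ) u₀) u₀ :=
    ((hΦ.fderiv_right (m := 1) (by norm_num)).differentiableAt (by simp)).hasFDerivAt
  -- Equality of mixed second derivatives of `Φ`; this plays the role of torsion-freeness.
  have hsymm := (hΦ.isSymmSndFDerivAt (by simp)) a b
  -- The relation `⟨v, dΦ b⟩ = 0` differentiated in direction `a`. On exchanging `a` and `b` and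
  -- subtracting, the Hessian terms cancel, and the remaining derivatives of `G` are exactly the
  -- antisymmetric part of the Christoffel terms.
  have key : ∀ a b, fderiv ℝ G (Φ u₀) (fderiv ℝ Φ u₀ a) (v u₀) (fderiv ℝ Φ u₀ b)
      + G (Φ u₀) (v' a) (fderiv ℝ Φ u₀ b)
      + G (Φ u₀) (v u₀) (fderiv ℝ (fderiv ℝ Φ) u₀ a b) = 0 := fun a b => by
    have h := HasFDerivAt.bilinear_apply hG hΦ' hv (hΦ''.clm_apply (hasFDerivAt_const b u₀))
    have h0 : HasFDerivAt (fun u => G (Φ u) (v u) (fderiv ℝ Φ u b)) (0 : D →L[ℝ] ℝ) u₀ :=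
      (hasFDerivAt_const (0 : ℝ) u₀).congr_of_eventuallyEq (hperp.mono fun u hu => hu b)
    simpa using DFunLike.congr_fun (h.unique h0) a
  have k1 := key a b
  have k2 := key b a
  rw [hsymm] at k1
  simp only [hΓ]
  rw [hG' (v u₀) (fderiv ℝ Φ u₀ a)]
  linarith

namespace LorentzianMetric

theorem eventually_mem_extChartAt_source {X N : Type*} {m : ℕ} [TopologicalSpace X]
    [TopologicalSpace N] [ChartedSpace (EuclideanSpace ℝ (Fin m)) N] {f : X → N} {p : X}
    (hf : ContinuousAt f p) : ∀ᶠ q in 𝓝 p, f q ∈ (extChartAt (𝓡 m) (f p)).source :=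
  hf.eventually (extChartAt_source_mem_nhds (I := 𝓡 m) (f p))

variable {m : ℕ} {N : Type*} [TopologicalSpace N]
  [ChartedSpace (EuclideanSpace ℝ (Fin m)) N]
  {k : ℕ} {M : Type*} [TopologicalSpace M] [ChartedSpace (EuclideanSpace ℝ (Fin k)) M]

/-- The representative of a vector field along a map in the chart around `f p`. -/
def fieldInChart (f : M → N) (W : (q : M) → TangentSpace (𝓡 m) (f q)) (p q : M) :
    EuclideanSpace ℝ (Fin m) :=
  mfderiv (𝓡 m) 𝓘(ℝ, EuclideanSpace ℝ (Fin m)) (extChartAt (𝓡 m) (f p)) (f q) (W q)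

variable (m) in
/-- The representative of a map in the chart around `f p`. -/
def mapInChart (f : M → N) (p q : M) : EuclideanSpace ℝ (Fin m) := extChartAt (𝓡 m) (f p) (f q)

variable [IsManifold (𝓡 m) ∞ N]

/-- The chart representative of a differentiable vector field along a map is differentiable. -/
theorem mdifferentiableAt_fieldInChart {f : M → N}
    {W : (q : M) → TangentSpace (𝓡 m) (f q)} {p : M}
    (hW : MDifferentiableAt (𝓡 k) (𝓡 m).tangent
      (fun q => (⟨f q, W q⟩ : TangentBundle (𝓡 m) N)) p) :
    MDifferentiableAt (𝓡 k) 𝓘(ℝ, EuclideanSpace ℝ (Fin m)) (fieldInChart f W p) p := by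
  have : IsManifold (𝓡 m) 1 N := .of_le (n := ∞) (by simp)
  obtain ⟨h1, h2⟩ := (mdifferentiableAt_totalSpace (𝓡 m) _).1 hW
  -- Over the chart domain, the fibre coordinate of the trivialization is the differential of the
  -- chart.
  refine h2.congr_of_eventuallyEq ?_
  filter_upwards [eventually_mem_extChartAt_source (m := m) h1.continuousAt] with q hq
  rw [extChartAt_source] at hq
  refine (DFunLike.congr_fun
    (TangentBundle.continuousLinearMapAt_trivializationAt (I := 𝓡 m) hq) (W q)).symm.trans ?_
  exact congrFun (Bundle.Trivialization.coe_linearMapAt_of_mem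
    (trivializationAt (EuclideanSpace ℝ (Fin m)) (TangentSpace (𝓡 m)) (f p)) hq) (W q)

theorem mdifferentiableAt_mapInChart {f : M → N} {p q : M}
    (hf : MDifferentiableAt (𝓡 k) (𝓡 m) f q) (hq : f q ∈ (extChartAt (𝓡 m) (f p)).source) :
    MDifferentiableAt (𝓡 k) 𝓘(ℝ, EuclideanSpace ℝ (Fin m)) (mapInChart m f p) q := by
  have : IsManifold (𝓡 m) 1 N := .of_le (n := ∞) (by simp)
  rw [extChartAt_source] at hq
  exact (mdifferentiableAt_extChartAt hq).comp q hf

theorem mfderiv_mapInChart_apply {f : M → N} {p q : M}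
    (hf : MDifferentiableAt (𝓡 k) (𝓡 m) f q) (hq : f q ∈ (extChartAt (𝓡 m) (f p)).source)
    (x : TangentSpace (𝓡 k) q) :
    mfderiv (𝓡 k) 𝓘(ℝ, EuclideanSpace ℝ (Fin m)) (mapInChart m f p) q x =
      (mfderiv (𝓡 m) 𝓘(ℝ, EuclideanSpace ℝ (Fin m)) (extChartAt (𝓡 m) (f p)) (f q)
        (mfderiv (𝓡 k) (𝓡 m) f q x) : EuclideanSpace ℝ (Fin m)) := by
  have : IsManifold (𝓡 m) 1 N := .of_le (n := ∞) (by simp)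
  rw [extChartAt_source] at hq
  exact DFunLike.congr_fun
    ((mdifferentiableAt_extChartAt hq).hasMFDerivAt.comp q hf.hasMFDerivAt).mfderiv x

/-- Metric compatibility in coordinates: in the two Koszul formulas the derivatives along `v` and
`w` cancel by symmetry of the form, and the derivative along `u` occurs twice with factor 1/2. -/
theorem gram_christoffel_add (g : LorentzianMetric m N) (x : N)
    (u v w : EuclideanSpace ℝ (Fin m)) :
    g.gram x (extChartAt (𝓡 m) x x) (g.christoffel x (extChartAt (𝓡 m) x x) v u) w
      + g.gram x (extChartAt (𝓡 m) x x) v (g.christoffel x (extChartAt (𝓡 m) x x) w u)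
      = fderiv ℝ (g.gram x) (extChartAt (𝓡 m) x x) u v w := by
  rw [g.gram_symm x _ v, gram_christoffel, gram_christoffel, g.fderiv_gram_symm x u w v,
    g.fderiv_gram_symm x w u v, g.fderiv_gram_symm x v w u]
  ring

/-- The covariant derivative in the chart, paired with a tangent vector. -/
theorem inner_covDerivAlong (g : LorentzianMetric m N) (f : M → N)
    (W : (q : M) → TangentSpace (𝓡 m) (f q)) (p : M) (x : TangentSpace (𝓡 k) p)
    (w : TangentSpace (𝓡 m) (f p)) :
    g.inner (f p) (g.covDerivAlong f W p x) w =
      g.gram (f p) (mapInChart m f p p)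
        (mfderiv (𝓡 k) 𝓘(ℝ, EuclideanSpace ℝ (Fin m)) (fieldInChart f W p) p x)
        (mfderiv (𝓡 m) 𝓘(ℝ, EuclideanSpace ℝ (Fin m)) (extChartAt (𝓡 m) (f p)) (f p) w)
      + g.gram (f p) (mapInChart m f p p)
        (g.christoffel (f p) (mapInChart m f p p) (fieldInChart f W p p)
          (mfderiv (𝓡 k) 𝓘(ℝ, EuclideanSpace ℝ (Fin m)) (mapInChart m f p) p x))
        (mfderiv (𝓡 m) 𝓘(ℝ, EuclideanSpace ℝ (Fin m)) (extChartAt (𝓡 m) (f p)) (f p) w) := by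
  have : IsManifold (𝓡 m) 1 N := .of_le (n := ∞) (by simp)
  have hx := mem_extChartAt_source (I := 𝓡 m) (f p)
  rw [← g.gram_mfderiv_extChartAt hx]
  have h := (isInvertible_mfderiv_extChartAt (I := 𝓡 m) hx).self_apply_inverse
  refine (congrArg (fun z : EuclideanSpace ℝ (Fin m) =>
    g.gram (f p) (extChartAt (𝓡 m) (f p) (f p)) z
      (mfderiv (𝓡 m) 𝓘(ℝ, EuclideanSpace ℝ (Fin m)) (extChartAt (𝓡 m) (f p)) (f p) w))
    (h _)).trans ?_
  exact DFunLike.congr_fun (map_add (g.gram (f p) (extChartAt (𝓡 m) (f p) (f p))) _ _) _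

/-- The Levi-Civita connection is compatible with the metric. -/
theorem hasMFDerivAt_inner (g : LorentzianMetric m N) {f : M → N} {p : M}
    {V W : (q : M) → TangentSpace (𝓡 m) (f q)}
    (hV : MDifferentiableAt (𝓡 k) (𝓡 m).tangent
      (fun q => (⟨f q, V q⟩ : TangentBundle (𝓡 m) N)) p)
    (hW : MDifferentiableAt (𝓡 k) (𝓡 m).tangent
      (fun q => (⟨f q, W q⟩ : TangentBundle (𝓡 m) N)) p) :
    ∃ L : EuclideanSpace ℝ (Fin k) →L[ℝ] ℝ,
      HasMFDerivAt (𝓡 k) 𝓘(ℝ, ℝ) (fun q => g.inner (f q) (V q) (W q)) p L ∧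
      ∀ x : TangentSpace (𝓡 k) p, L x = g.inner (f p) (g.covDerivAlong f V p x) (W p)
        + g.inner (f p) (V p) (g.covDerivAlong f W p x) := by
  have hf : MDifferentiableAt (𝓡 k) (𝓡 m) f p := ((mdifferentiableAt_totalSpace (𝓡 m) _).1 hV).1
  have hF := mdifferentiableAt_mapInChart (p := p) hf (mem_extChartAt_source (f p))
  have key := HasMFDerivAt.bilinear_apply (y := mapInChart m f p) (v := fieldInChart f V p)
    (w := fieldInChart f W p) (G := g.gram (f p)) (g.differentiableAt_gram (f p))
    hF.hasMFDerivAt (mdifferentiableAt_fieldInChart hV).hasMFDerivAt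
    (mdifferentiableAt_fieldInChart hW).hasMFDerivAt
  refine ⟨_, key.congr_of_eventuallyEq ?_, fun x => ?_⟩
  · filter_upwards [eventually_mem_extChartAt_source (m := m) hf.continuousAt] with q hq
    exact (g.gram_mfderiv_extChartAt hq _ _).symm
  · have h1 := g.gram_christoffel_add (f p)
      (mfderiv (𝓡 k) 𝓘(ℝ, EuclideanSpace ℝ (Fin m)) (mapInChart m f p) p x)
      (fieldInChart f V p p) (fieldInChart f W p p)
    have h2 := g.inner_covDerivAlong f V p x (W p)
    have h3 := g.inner_covDerivAlong f W p x (V p)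
    rw [g.symm] at h3
    have e := g.gram_symm (f p) (mapInChart m f p p) (fieldInChart f V p p)
    have aux : ∀ {d a b b' c₁ c₂ c₂' l₁ l₂ : ℝ}, c₁ + c₂ = d → l₁ = a + c₁ → l₂ = b' + c₂' →
        b = b' → c₂ = c₂' → d + a + b = l₁ + l₂ := by
      intros; linarith
    exact aux h1 h2 h3 (e _) (e _)

/-- A field `V` normal to the images under `f` of the leaf parametrised by `c` has a symmetric
shape operator. -/
theorem inner_covDerivAlong_comm {l : ℕ} (g : LorentzianMetric m N)
    {f : M → N} {c : EuclideanSpace ℝ (Fin l) → M} {u₀ : EuclideanSpace ℝ (Fin l)}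
    {V : (q : M) → TangentSpace (𝓡 m) (f q)} (hf : ContMDiff (𝓡 k) (𝓡 m) ∞ f)
    (hc : ∀ᶠ u in 𝓝 u₀, ContMDiffAt (𝓡 l) (𝓡 k) ∞ c u)
    (hV : MDifferentiableAt (𝓡 k) (𝓡 m).tangent
      (fun q => (⟨f q, V q⟩ : TangentBundle (𝓡 m) N)) (c u₀))
    (hperp : ∀ᶠ u in 𝓝 u₀, ∀ a : EuclideanSpace ℝ (Fin l), g.inner (f (c u)) (V (c u))
      (mfderiv (𝓡 k) (𝓡 m) f (c u) (mfderiv (𝓡 l) (𝓡 k) c u a)) = 0)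
    (a b : EuclideanSpace ℝ (Fin l)) :
    g.inner (f (c u₀)) (g.covDerivAlong f V (c u₀) (mfderiv (𝓡 l) (𝓡 k) c u₀ a))
      (mfderiv (𝓡 k) (𝓡 m) f (c u₀) (mfderiv (𝓡 l) (𝓡 k) c u₀ b)) =
    g.inner (f (c u₀)) (g.covDerivAlong f V (c u₀) (mfderiv (𝓡 l) (𝓡 k) c u₀ b))
      (mfderiv (𝓡 k) (𝓡 m) f (c u₀) (mfderiv (𝓡 l) (𝓡 k) c u₀ a)) := by
  have hc₀ := hc.self_of_nhds
  have hfc : ContMDiffAt (𝓡 l) (𝓡 m) ∞ (fun u => f (c u)) u₀ := (hf _).comp u₀ hc₀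
  let Φ : EuclideanSpace ℝ (Fin l) → EuclideanSpace ℝ (Fin m) :=
    fun u => mapInChart m f (c u₀) (c u)
  let v : EuclideanSpace ℝ (Fin l) → EuclideanSpace ℝ (Fin m) :=
    fun u => fieldInChart f V (c u₀) (c u)
  have hΦ : ContDiffAt ℝ ∞ Φ u₀ := by
    rw [← contMDiffAt_iff_contDiffAt]
    exact (contMDiffAt_extChartAt (I := 𝓡 m) (n := ∞) (x := f (c u₀))).comp u₀ hfc
  have hsrc := eventually_mem_extChartAt_source (m := m) hfc.continuousAt
  have hd : ∀ u, ContMDiffAt (𝓡 l) (𝓡 k) ∞ c u →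
      f (c u) ∈ (extChartAt (𝓡 m) (f (c u₀))).source → ∀ e : EuclideanSpace ℝ (Fin l),
      fderiv ℝ Φ u e = mfderiv (𝓡 k) 𝓘(ℝ, EuclideanSpace ℝ (Fin m))
        (mapInChart m f (c u₀)) (c u) (mfderiv (𝓡 l) (𝓡 k) c u e) := by
    intro u hcu hu e
    have h := (mdifferentiableAt_mapInChart ((hf (c u)).mdifferentiableAt (by simp))
      hu).hasMFDerivAt.comp u (hcu.mdifferentiableAt (by simp)).hasMFDerivAt
    rw [← mfderiv_eq_fderiv]
    exact DFunLike.congr_fun h.mfderiv e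
  have hv : HasFDerivAt v (mfderiv 𝓘(ℝ, EuclideanSpace ℝ (Fin l))
      𝓘(ℝ, EuclideanSpace ℝ (Fin m)) v u₀) u₀ := by
    rw [← hasMFDerivAt_iff_hasFDerivAt]
    exact ((mdifferentiableAt_fieldInChart hV).comp u₀
      (hc₀.mdifferentiableAt (by simp))).hasMFDerivAt
  have hv' : ∀ e : EuclideanSpace ℝ (Fin l), mfderiv 𝓘(ℝ, EuclideanSpace ℝ (Fin l))
      𝓘(ℝ, EuclideanSpace ℝ (Fin m)) v u₀ e = mfderiv (𝓡 k) 𝓘(ℝ, EuclideanSpace ℝ (Fin m))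
        (fieldInChart f V (c u₀)) (c u₀) (mfderiv (𝓡 l) (𝓡 k) c u₀ e) := fun e =>
    DFunLike.congr_fun ((mdifferentiableAt_fieldInChart hV).hasMFDerivAt.comp u₀
      (hc₀.mdifferentiableAt (by simp)).hasMFDerivAt).mfderiv e
  have key := bilinear_apply_covDeriv_comm (G := g.gram (f (c u₀))) (Φ := Φ) (v := v)
    (Γ := fun z => g.christoffel (f (c u₀)) (Φ u₀) (v u₀) z)
    (g.differentiableAt_gram (f (c u₀))) (g.fderiv_gram_symm (f (c u₀)))
    (hΦ.of_le (ENat.LEInfty.out)) hv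
    (fun z w => g.gram_christoffel (f (c u₀)) z (v u₀) w) (by
      filter_upwards [hc, hsrc, hperp] with u h1 h2 h3 e
      rw [hd u h1 h2 e, mfderiv_mapInChart_apply ((hf (c u)).mdifferentiableAt (by simp)) h2]
      exact (g.gram_mfderiv_extChartAt h2 _ _).trans (h3 e)) a b
  rw [inner_covDerivAlong, inner_covDerivAlong]
  have hm := fun e => hd u₀ hc₀ (mem_extChartAt_source _) e
  have hm' := fun e => (hm e).trans (mfderiv_mapInChart_apply
    ((hf (c u₀)).mdifferentiableAt (by simp)) (mem_extChartAt_source _) _)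
  rw [← hm', ← hm', ← hm, ← hm, ← hv', ← hv']
  exact key

end LorentzianMetric
end

/-! ### Null frames and the normal component of a field -/

noncomputable section

theorem mdifferentiableAt_smul_add_smul_along {m k : ℕ} {N M : Type*} [TopologicalSpace N]
    [ChartedSpace (EuclideanSpace ℝ (Fin m)) N] [IsManifold (𝓡 m) ∞ N] [TopologicalSpace M]
    [ChartedSpace (EuclideanSpace ℝ (Fin k)) M] {f : M → N} {p : M} {a b : M → ℝ}
    {V W : (q : M) → TangentSpace (𝓡 m) (f q)}
    (ha : MDifferentiableAt (𝓡 k) 𝓘(ℝ, ℝ) a p) (hb : MDifferentiableAt (𝓡 k) 𝓘(ℝ, ℝ) b p)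
    (hV : MDifferentiableAt (𝓡 k) (𝓡 m).tangent
      (fun q => (⟨f q, V q⟩ : TangentBundle (𝓡 m) N)) p)
    (hW : MDifferentiableAt (𝓡 k) (𝓡 m).tangent
      (fun q => (⟨f q, W q⟩ : TangentBundle (𝓡 m) N)) p) :
    MDifferentiableAt (𝓡 k) (𝓡 m).tangent
      (fun q => (⟨f q, a q • V q + b q • W q⟩ : TangentBundle (𝓡 m) N)) p := by
  have : IsManifold (𝓡 m) 1 N := .of_le (n := ∞) (by simp)
  obtain ⟨h1, hV'⟩ := (mdifferentiableAt_totalSpace (𝓡 m) _).1 hV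
  obtain ⟨-, hW'⟩ := (mdifferentiableAt_totalSpace (𝓡 m) _).1 hW
  refine (mdifferentiableAt_totalSpace (𝓡 m) _).2 ⟨h1, ?_⟩
  refine ((ha.smul hV').add (hb.smul hW')).congr_of_eventuallyEq ?_
  filter_upwards [LorentzianMetric.eventually_mem_extChartAt_source (m := m) h1.continuousAt]
    with q hq
  rw [extChartAt_source] at hq
  have h := congrFun (Bundle.Trivialization.coe_linearMapAt_of_mem (R := ℝ)
    (trivializationAt (EuclideanSpace ℝ (Fin m)) (TangentSpace (𝓡 m)) (f p)) hq)
  refine (h _).symm.trans ?_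
  rw [map_add, map_smul, map_smul, h, h]
  rfl

namespace NullHypersurface

variable {n : ℕ} {N : Type*} [TopologicalSpace N]
  [ChartedSpace (EuclideanSpace ℝ (Fin (n + 2))) N] [IsManifold (𝓡 (n + 2)) ∞ N]
  {g : LorentzianMetric (n + 2) N} {M : Type*} [TopologicalSpace M]
  [ChartedSpace (EuclideanSpace ℝ (Fin (n + 1))) M] [IsManifold (𝓡 (n + 1)) ∞ M]
  {H : NullHypersurface g M}

theorem inner_diff_of_mem_radical {p : M} {r : TangentSpace (𝓡 (n + 1)) p}
    (hr : r ∈ (g.radical H.map p : Submodule ℝ (TangentSpace (𝓡 (n + 1)) p)))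
    (x : TangentSpace (𝓡 (n + 1)) p) :
    g.inner (H.map p) (H.diff p r) (H.diff p x) = 0 :=
  DFunLike.congr_fun (LinearMap.mem_ker.1 hr) x

theorem finrank_screen (H : NullHypersurface g M) (p : M) :
    Module.finrank ℝ (H.screen p) = n := by
  obtain ⟨U, hU, e, -, he⟩ := H.screen_smooth p
  obtain ⟨h1, h2⟩ := he p (mem_of_mem_nhds hU)
  rw [← h2, finrank_span_eq_card h1, Fintype.card_fin]

theorem finrank_radical (H : NullHypersurface g M) (p : M) :
    Module.finrank ℝ (g.radical H.map p : Submodule ℝ (TangentSpace (𝓡 (n + 1)) p)) = 1 := by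
  have : FiniteDimensional ℝ (TangentSpace (𝓡 (n + 1)) p) :=
    inferInstanceAs (FiniteDimensional ℝ (EuclideanSpace ℝ (Fin (n + 1))))
  have h := Submodule.finrank_add_eq_of_isCompl (H.isCompl p)
  have h' : Module.finrank ℝ (TangentSpace (𝓡 (n + 1)) p) = n + 1 :=
    finrank_euclideanSpace_fin (𝕜 := ℝ)
  rw [H.finrank_screen, h'] at h
  omega

namespace IsNullFrame

variable {ξ : (p : M) → TangentSpace (𝓡 (n + 1)) p} {ν : H.FieldAlong}

/-- The radical is a line, and `ξ p` is nonzero because it pairs to 1 with `ν p`. -/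
theorem exists_smul_eq (hF : H.IsNullFrame ξ ν) {p : M} {r : TangentSpace (𝓡 (n + 1)) p}
    (hr : r ∈ (g.radical H.map p : Submodule ℝ (TangentSpace (𝓡 (n + 1)) p))) :
    ∃ c : ℝ, c • ξ p = r := by
  have hξ : (⟨ξ p, hF.mem_radical p⟩ :
      (g.radical H.map p : Submodule ℝ (TangentSpace (𝓡 (n + 1)) p))) ≠ 0 := fun h => by
    have h0 : ξ p = 0 := congrArg Subtype.val h
    have := hF.pairing p
    rw [h0] at this
    simp at this
  obtain ⟨c, hc⟩ := (finrank_eq_one_iff_of_nonzero' _ hξ).1 (H.finrank_radical p) ⟨r, hr⟩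
  exact ⟨c, congrArg Subtype.val hc⟩

/-- The kernel of the differential lies in the radical, so its elements are multiples `c • ξ p`;
pairing with `ν p` gives `c = 0`. -/
theorem diff_injective (hF : H.IsNullFrame ξ ν) (p : M) : Function.Injective (H.diff p) := by
  rw [injective_iff_map_eq_zero]
  intro x hx
  have hr : x ∈ (g.radical H.map p : Submodule ℝ (TangentSpace (𝓡 (n + 1)) p)) := by
    refine LinearMap.mem_ker.2 (LinearMap.ext fun y => ?_)
    change g.inner (H.map p) (H.diff p x) (H.diff p y) = 0
    rw [hx]
    simp
  obtain ⟨c, rfl⟩ := hF.exists_smul_eq hr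
  have h : g.inner (H.map p) (H.diff p (c • ξ p)) (ν p) = c := by
    rw [map_smul, map_smul, smul_apply, hF.pairing]
    simp
  rw [hx] at h
  rw [← h]
  simp

/-- The screen, `ξ` and `ν` span the tangent spaces of the ambient manifold. -/
theorem eq_zero_of_inner_eq_zero (hF : H.IsNullFrame ξ ν) {p : M}
    {w : TangentSpace (𝓡 (n + 2)) (H.map p)}
    (hs : ∀ x ∈ H.screen p, g.inner (H.map p) w (H.diff p x) = 0)
    (hξ : g.inner (H.map p) w (H.diff p (ξ p)) = 0) (hν : g.inner (H.map p) w (ν p) = 0) :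
    w = 0 := by
  have : FiniteDimensional ℝ (TangentSpace (𝓡 (n + 2)) (H.map p)) :=
    inferInstanceAs (FiniteDimensional ℝ (EuclideanSpace ℝ (Fin (n + 2))))
  let K : Submodule ℝ (TangentSpace (𝓡 (n + 2)) (H.map p)) :=
    LinearMap.ker (g.inner (H.map p) w).toLinearMap
  have hle : LinearMap.range (H.diff p).toLinearMap ≤ K := by
    rintro _ ⟨x, rfl⟩
    have hx : x ∈ H.screen p ⊔ g.radical H.map p := by
      rw [(H.isCompl p).sup_eq_top]; trivial
    obtain ⟨s, hs', r, hr, rfl⟩ := Submodule.mem_sup.1 hx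
    obtain ⟨c, rfl⟩ := hF.exists_smul_eq hr
    change g.inner (H.map p) w (H.diff p (s + c • ξ p)) = 0
    rw [map_add, map_add, hs s hs', map_smul, map_smul, hξ]
    simp
  -- The image of `diff` has dimension n + 1 and misses `ν p`: it is orthogonal to `ξ p`, whereas `ν
  -- p` is not. So the kernel `K` of `⟨w, ·⟩` is the whole (n+2)-dimensional space.
  have hlt : LinearMap.range (H.diff p).toLinearMap < K := by
    refine lt_of_le_of_ne hle fun h => ?_
    have hmem : ν p ∈ K := hν
    rw [← h] at hmem
    obtain ⟨x, hx⟩ := hmem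
    have h1 := hF.pairing p
    rw [← hx] at h1
    exact zero_ne_one ((inner_diff_of_mem_radical (hF.mem_radical p) x).symm.trans h1)
  have h1 := Submodule.finrank_lt_finrank_of_lt hlt
  rw [LinearMap.finrank_range_of_inj (hF.diff_injective p)] at h1
  have h2 : Module.finrank ℝ (TangentSpace (𝓡 (n + 1)) p) = n + 1 :=
    finrank_euclideanSpace_fin (𝕜 := ℝ)
  have h3 : Module.finrank ℝ (TangentSpace (𝓡 (n + 2)) (H.map p)) = n + 2 :=
    finrank_euclideanSpace_fin (𝕜 := ℝ)
  have hK : K = ⊤ := Submodule.eq_top_of_finrank_eq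
    (le_antisymm (Submodule.finrank_le K) (by omega))
  refine g.nondegenerate _ fun v => ?_
  have hv : v ∈ K := hK ▸ Submodule.mem_top
  exact hv

/-- The two sides have equal products with the screen, `ξ` and `ν`. Since `ξ` and `ν` are null and
dual to each other, the coefficient of each is the product of `Z` with the other. -/
theorem perpPart_eq (hF : H.IsNullFrame ξ ν) (Z : H.FieldAlong) (p : M) :
    H.perpPart Z p = g.inner (H.map p) (Z p) (ν p) • H.diff p (ξ p)
      + g.inner (H.map p) (Z p) (H.diff p (ξ p)) • ν p := by
  have hrad := inner_diff_of_mem_radical (hF.mem_radical p)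
  have hpair : g.inner (H.map p) (ν p) (H.diff p (ξ p)) = 1 := by rw [g.symm, hF.pairing]
  have hsξ : g.inner (H.map p) (H.diff p (H.screenPart Z p)) (H.diff p (ξ p)) = 0 := by
    rw [g.symm, hrad]
  have hsν : g.inner (H.map p) (H.diff p (H.screenPart Z p)) (ν p) = 0 := by
    rw [g.symm, hF.orthogonal p _ (H.screenPart Z p).2]
  rw [← sub_eq_zero]
  refine hF.eq_zero_of_inner_eq_zero (fun x hx => ?_) ?_ ?_
  · have h1 : g.inner (H.map p) (H.diff p (H.screenPart Z p)) (H.diff p x) =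
        g.inner (H.map p) (Z p) (H.diff p x) := H.screenProj_spec p (Z p) ⟨x, hx⟩
    simp [perpPart, h1, hrad, hF.orthogonal p x hx]
  · simp [perpPart, hsξ, hrad, hpair]
  · simp [perpPart, hsν, hF.pairing, hF.null]

theorem inner_perpPart_self (hF : H.IsNullFrame ξ ν) (Z : H.FieldAlong) (p : M) :
    g.inner (H.map p) (H.perpPart Z p) (H.perpPart Z p) =
      2 * (g.inner (H.map p) (Z p) (H.diff p (ξ p)) * g.inner (H.map p) (Z p) (ν p)) := by
  have hrad := inner_diff_of_mem_radical (hF.mem_radical p)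
  have hpair : g.inner (H.map p) (ν p) (H.diff p (ξ p)) = 1 := by rw [g.symm, hF.pairing]
  rw [hF.perpPart_eq]
  simp [hrad, hpair, hF.pairing, hF.null]
  ring

/-- The value agrees with `inner_perpPart_self`, because `Z^⊥` is the orthogonal projection of `Z`.
-/
theorem inner_perpPart (hF : H.IsNullFrame ξ ν) (Z : H.FieldAlong) (p : M) :
    g.inner (H.map p) (H.perpPart Z p) (Z p) =
      2 * (g.inner (H.map p) (Z p) (H.diff p (ξ p)) * g.inner (H.map p) (Z p) (ν p)) := by
  rw [hF.perpPart_eq, g.symm]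
  simp
  ring

/-- The pointwise definition through `screenProj` does not display regularity; the frame formula
does, its coefficients being products of smooth fields. -/
theorem mdifferentiableAt_perpPart (hF : H.IsNullFrame ξ ν) {Z : H.FieldAlong}
    (hZ : H.IsSmooth Z) (p : M) :
    MDifferentiableAt (𝓡 (n + 1)) (𝓡 (n + 2)).tangent
      (fun q => (⟨H.map q, H.perpPart Z q⟩ : TangentBundle (𝓡 (n + 2)) N)) p := by
  have hξ : MDifferentiableAt (𝓡 (n + 1)) (𝓡 (n + 2)).tangent
      (fun q => (⟨H.map q, H.diff q (ξ q)⟩ : TangentBundle (𝓡 (n + 2)) N)) p :=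
    ((H.isImmersion.contMDiff.contMDiff_tangentMap (m := ∞) (by simp)).comp
      hF.smooth_radical).mdifferentiableAt (by simp)
  have hν := hF.smooth_transversal.mdifferentiableAt (x := p) (by simp)
  have hZ' := hZ.mdifferentiableAt (x := p) (by simp)
  obtain ⟨L₁, h₁, -⟩ := g.hasMFDerivAt_inner hZ' hν
  obtain ⟨L₂, h₂, -⟩ := g.hasMFDerivAt_inner hZ' hξ
  have := mdifferentiableAt_smul_add_smul_along h₁.mdifferentiableAt h₂.mdifferentiableAt hξ hν
  simp only [hF.perpPart_eq]
  exact this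

end IsNullFrame

/-! ### Symmetry on the screen and constancy along parallel fields -/

theorem inner_perpPart_diff (H : NullHypersurface g M) (Z : H.FieldAlong) {p : M}
    {x : TangentSpace (𝓡 (n + 1)) p} (hx : x ∈ H.screen p) :
    g.inner (H.map p) (H.perpPart Z p) (H.diff p x) = 0 := by
  have h : g.inner (H.map p) (H.diff p (H.screenPart Z p)) (H.diff p x) =
      g.inner (H.map p) (Z p) (H.diff p x) := H.screenProj_spec p (Z p) ⟨x, hx⟩
  simp [perpPart, h]

/-- For an integrable screen, the shape operators in the normal directions are symmetric. -/
theorem ScreenIntegrable.inner_covDerivAlong_comm (hint : H.ScreenIntegrable) {V : H.FieldAlong}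
    {p : M} (hV : MDifferentiableAt (𝓡 (n + 1)) (𝓡 (n + 2)).tangent
      (fun q => (⟨H.map q, V q⟩ : TangentBundle (𝓡 (n + 2)) N)) p)
    (hperp : ∀ q, ∀ x ∈ H.screen q, g.inner (H.map q) (V q) (H.diff q x) = 0)
    {x y : TangentSpace (𝓡 (n + 1)) p} (hx : x ∈ H.screen p) (hy : y ∈ H.screen p) :
    g.inner (H.map p) (g.covDerivAlong H.map V p x) (H.diff p y) =
      g.inner (H.map p) (g.covDerivAlong H.map V p y) (H.diff p x) := by
  obtain ⟨c, U, hU, h0, rfl, hc⟩ := hint p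
  have hev : ∀ᶠ u in 𝓝 0, u ∈ U := hU.mem_nhds h0
  rw [← (hc 0 h0).2] at hx hy
  obtain ⟨a, rfl⟩ := hx
  obtain ⟨b, rfl⟩ := hy
  exact g.inner_covDerivAlong_comm H.isImmersion.contMDiff
    (hev.mono fun u hu => (hc u hu).1.contMDiffAt) hV
    -- Normality is needed along the whole leaf near `p`, since the symmetry comes from
    -- differentiating it.
    (hev.mono fun u hu a => hperp _ _ ((hc u hu).2 ▸ ⟨a, rfl⟩)) a b

theorem screenProj_eq_zero (H : NullHypersurface g M) {p : M}
    {v : TangentSpace (𝓡 (n + 2)) (H.map p)}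
    (hv : ∀ y ∈ H.screen p, g.inner (H.map p) v (H.diff p y) = 0) : H.screenProj p v = 0 := by
  refine (H.screenMetric_nondegenerate p).1 _ fun y => ?_
  exact (H.screenProj_spec p v y).trans (hv y y.2)

/-- For a parallel field `Z` of constant angle, `|Z|` and hence the products of the components of
`Z` in the null frame have vanishing derivative. -/
theorem hasMFDerivAt_inner_mul_inner {Z : H.FieldAlong} (hZ : H.IsSmooth Z)
    (hpar : H.IsParallel Z) (hne : ∀ p, g.inner (H.map p) (Z p) (Z p) ≠ 0)
    {X Y : H.FieldAlong} {a b : ℝ}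
    (ha : ∀ p, g.inner (H.map p) (Z p) (X p) / H.length Z p = a)
    (hb : ∀ p, g.inner (H.map p) (Z p) (Y p) / H.length Z p = b) (p : M) :
    HasMFDerivAt (𝓡 (n + 1)) 𝓘(ℝ, ℝ) (fun q =>
      2 * (g.inner (H.map q) (Z q) (X q) * g.inner (H.map q) (Z q) (Y q))) p
      (0 : EuclideanSpace ℝ (Fin (n + 1)) →L[ℝ] ℝ) := by
  have hZ' := hZ.mdifferentiableAt (x := p) (by simp)
  obtain ⟨L, hL, hL'⟩ := g.hasMFDerivAt_inner hZ' hZ'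
  have hL0 : L = 0 := ContinuousLinearMap.ext fun x => by
    rw [hL' x, hpar p x]
    simp
  subst hL0
  -- The two quotients are `a` and `b`, so the product is `a * b * |Z|²` with `|Z|² = |ḡ(Z,Z)|`.
  have heq : (fun q => 2 * (g.inner (H.map q) (Z q) (X q) * g.inner (H.map q) (Z q) (Y q))) =
      (fun t : ℝ => 2 * (a * b) * |t|) ∘ fun q => g.inner (H.map q) (Z q) (Z q) := by
    funext q
    have hl : H.length Z q * H.length Z q = |g.inner (H.map q) (Z q) (Z q)| :=
      Real.mul_self_sqrt (abs_nonneg _)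
    have hl0 : H.length Z q ≠ 0 := fun h => by
      rw [h, mul_zero] at hl
      exact hne q (abs_eq_zero.1 hl.symm)
    rw [Function.comp_apply, ← hl, ← ha q, ← hb q]
    field_simp
  -- The absolute value is differentiable here since `ḡ(Z,Z) ≠ 0`; its derivative is irrelevant,
  -- being composed with `0`.
  have habs : HasMFDerivAt 𝓘(ℝ, ℝ) 𝓘(ℝ, ℝ) (fun t : ℝ => 2 * (a * b) * |t|)
      (g.inner (H.map p) (Z p) (Z p)) _ :=
    (((differentiableAt_abs (hne p)).const_mul (2 * (a * b))).hasFDerivAt).hasMFDerivAt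
  have := habs.comp p hL
  rw [heq]
  exact this.congr_mfderiv (ContinuousLinearMap.comp_zero _)

end NullHypersurface

end

/-! ### The main theorem -/

theorem mainTheorem9 {n : ℕ} {N : Type*} [TopologicalSpace N]
    [ChartedSpace (EuclideanSpace ℝ (Fin (n + 2))) N] [IsManifold (𝓡 (n + 2)) ∞ N]
    (g : LorentzianMetric (n + 2) N) {M : Type*} [TopologicalSpace M]
    [ChartedSpace (EuclideanSpace ℝ (Fin (n + 1))) M] [IsManifold (𝓡 (n + 1)) ∞ M]
    (H : NullHypersurface g M) (hint : H.ScreenIntegrable)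
    (Z : H.FieldAlong) (hZ : H.IsSmooth Z) (hpar : H.IsParallel Z)
    (hangle : H.HasConstantAngle Z) (p : M) :
    H.shapeOperator (H.perpPart Z) p (H.screenPart Z p) = 0 ∧
      (H.screenPart Z p ≠ 0 →
        Module.End.HasEigenvector (H.shapeOperator (H.perpPart Z) p) 0 (H.screenPart Z p)) := by
  obtain ⟨hne, ξ, ν, hF, ⟨a, ha⟩, ⟨b, hb⟩⟩ := hangle
  have hV := hF.mdifferentiableAt_perpPart hZ p
  have hconst := NullHypersurface.hasMFDerivAt_inner_mul_inner
    (X := fun p => H.diff p (ξ p)) hZ hpar hne ha hb p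
  have key : H.shapeOperator (H.perpPart Z) p (H.screenPart Z p) = 0 := by
    refine neg_eq_zero.2 (H.screenProj_eq_zero fun y hy => ?_)
    obtain ⟨L₁, h₁, h₁'⟩ := g.hasMFDerivAt_inner hV (hZ.mdifferentiableAt (x := p) (by simp))
    obtain ⟨L₂, h₂, h₂'⟩ := g.hasMFDerivAt_inner hV hV
    -- Both `⟨Z^⊥, Z⟩` and `⟨Z^⊥, Z^⊥⟩` are rewritten as the function whose derivative vanishes by
    -- `hconst`.
    replace h₁ := h₁.congr_of_eventuallyEq (.of_forall fun q => (hF.inner_perpPart Z q).symm)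
    replace h₂ := h₂.congr_of_eventuallyEq (.of_forall fun q => (hF.inner_perpPart_self Z q).symm)
    have e₁ : L₁ = 0 := h₁.mfderiv.symm.trans hconst.mfderiv
    have e₂ : L₂ = 0 := h₂.mfderiv.symm.trans hconst.mfderiv
    have k₁ := h₁' y
    have k₂ := h₂' y
    rw [e₁, hpar p y, map_zero, add_zero] at k₁
    rw [e₂, g.symm _ (H.perpPart Z p)] at k₂
    have hs : H.diff p (H.screenPart Z p) = Z p - H.perpPart Z p := by
      simp [NullHypersurface.perpPart]
    -- Symmetry moves the derivative from `Z*` to `y`; then `Z* = Z - Z^⊥` leaves the two products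
    -- that `k₁` and `k₂` show to be zero.
    refine (hint.inner_covDerivAlong_comm hV (fun q x hx => H.inner_perpPart_diff Z hx)
      (H.screenPart Z p).2 hy).trans ?_
    rw [hs, map_sub]
    have z : (0 : EuclideanSpace ℝ (Fin (n + 1)) →L[ℝ] ℝ) y = 0 := rfl
    linarith
  exact ⟨key, fun h => ⟨Module.End.mem_eigenspace_iff.2 (by rw [key, zero_smul]), h⟩⟩
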